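/- Let $A$ be a unital C$^*$-algebra, let $\varphi$ be a state on $A$, and let $A_\varphi=\{a\in A : \varphi(ab)=\varphi(ba)\text{ for all } b\in A\}$ be its centralizer, which is a unital C$^*$-subalgebra of $A$. Denote by $A_\varphi^{op}$ the opposite C$^*$-algebra of $A_\varphi$ (the same Banach space and involution, with the product reversed), and by $A_\varphi^{op}\otimes_{\max}A$ the maximal C$^*$-tensor product, that is, the completion of the algebraic tensor product over $\mathbb{C}$ in its largest C$^*$-norm. Then there exists a unique state $\Phi$ on $A_\varphi^{op}\otimes_{\max}A$ such that $\Phi(a\otimes b)=\varphi(ab)$ for all $a\in A_\varphi$ and $b\in A$. -/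

import Mathlib

open scoped TensorProduct ComplexOrder

noncomputable section

/-! ### States and centralizers -/

/-- A state on a unital C⋆-algebra: a positive linear functional `φ` with `φ 1 = 1`. -/
structure CStarState (A : Type*) [CStarAlgebra A] extends A →ₗ[ℂ] ℂ where
  nonneg' : ∀ a : A, 0 ≤ toFun (star a * a)
  map_one' : toFun 1 = 1

namespace CStarState

variable {A : Type*} [CStarAlgebra A]

instance : CoeFun (CStarState A) (fun _ => A → ℂ) := ⟨fun φ => φ.toLinearMap⟩

theorem nonneg (φ : CStarState A) (a : A) : 0 ≤ φ (star a * a) := φ.nonneg' a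

theorem continuous (φ : CStarState A) : Continuous φ := by
  let _ : PartialOrder A := CStarAlgebra.spectralOrder A
  have _ : StarOrderedRing A := CStarAlgebra.spectralOrderedRing A
  have h : ∀ a : A, 0 ≤ a → 0 ≤ φ.toLinearMap a := by
    intro a ha
    obtain ⟨b, rfl⟩ := CStarAlgebra.nonneg_iff_eq_star_mul_self.mp ha
    exact φ.nonneg b
  exact map_continuous (PositiveLinearMap.mk₀ φ.toLinearMap h)

theorem map_star (φ : CStarState A) (a : A) : φ (star a) = star (φ a) := by
  let _ : PartialOrder A := CStarAlgebra.spectralOrder A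
  have _ : StarOrderedRing A := CStarAlgebra.spectralOrderedRing A
  have h : ∀ a : A, 0 ≤ a → 0 ≤ φ.toLinearMap a := by
    intro a ha
    obtain ⟨b, rfl⟩ := CStarAlgebra.nonneg_iff_eq_star_mul_self.mp ha
    exact φ.nonneg b
  exact StarHomClass.map_star (PositiveLinearMap.mk₀ φ.toLinearMap h) a

/-- The centralizer `A_φ = {a | ∀ b, φ (a * b) = φ (b * a)}` of a state `φ`, with its structure of
a unital ⋆-subalgebra. -/
def centralizer (φ : CStarState A) : StarSubalgebra ℂ A where
  carrier := {a | ∀ b, φ (a * b) = φ (b * a)}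
  mul_mem' {x y} hx hy b := by
    rw [mul_assoc, hx, mul_assoc, hy, mul_assoc]
  add_mem' {x y} hx hy b := by
    rw [add_mul, mul_add, map_add, map_add, hx, hy]
  algebraMap_mem' r b := by rw [Algebra.commutes]
  star_mem' {a} ha b := by
    have h := congrArg star (ha (star b))
    rw [← φ.map_star, ← φ.map_star, star_mul, star_mul, star_star] at h
    exact h.symm

theorem mem_centralizer (φ : CStarState A) {a : A} :
    a ∈ φ.centralizer ↔ ∀ b, φ (a * b) = φ (b * a) := Iff.rfl

theorem isClosed_centralizer (φ : CStarState A) : IsClosed (φ.centralizer : Set A) := by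
  have h : (φ.centralizer : Set A) = ⋂ b : A, {a | φ (a * b) = φ (b * a)} := by
    ext a
    simp [mem_centralizer]
  rw [h]
  refine isClosed_iInter fun b => isClosed_eq ?_ ?_
  · exact φ.continuous.comp (continuous_id.mul continuous_const)
  · exact φ.continuous.comp (continuous_const.mul continuous_id)

/-- The centralizer is a unital C⋆-algebra, being norm closed. -/
instance (φ : CStarState A) : CStarAlgebra φ.centralizer :=
  StarSubalgebra.cstarAlgebra _ (h_closed := φ.isClosed_centralizer)

end CStarState

/-! ### C⋆-seminorms on ⋆-algebras and the associated C⋆-completions -/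

/-- A C⋆-seminorm on a complex ⋆-algebra. -/
structure CStarSeminorm (E : Type*) [Ring E] [StarRing E] [Algebra ℂ E] extends
    Seminorm ℂ E where
  mul_le_mul' : ∀ x y, toFun (x * y) ≤ toFun x * toFun y
  star_mul_self' : ∀ x, toFun (star x * x) = toFun x * toFun x

namespace CStarSeminorm

variable {E : Type*} [Ring E] [StarRing E] [Algebra ℂ E]

instance : CoeFun (CStarSeminorm E) (fun _ => E → ℝ) := ⟨fun p => p.toSeminorm⟩

theorem mul_le (p : CStarSeminorm E) (x y : E) : p (x * y) ≤ p x * p y := p.mul_le_mul' x y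

theorem star_mul_self (p : CStarSeminorm E) (x : E) : p (star x * x) = p x * p x :=
  p.star_mul_self' x

theorem map_star (p : CStarSeminorm E) (x : E) : p (star x) = p x := by
  have key : ∀ y : E, p y ≤ p (star y) := by
    intro y
    have h1 := p.star_mul_self y
    have h2 := p.mul_le (star y) y
    rcases (apply_nonneg p.toSeminorm y).eq_or_lt with h | h
    · rw [← h]
      exact apply_nonneg p.toSeminorm _
    · rw [h1] at h2
      exact le_of_mul_le_mul_right h2 h
  refine le_antisymm ?_ (key x)
  simpa using key (star x)

theorem map_one_le (p : CStarSeminorm E) : p 1 ≤ 1 := by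
  have h := p.star_mul_self 1
  rw [star_one, one_mul] at h
  rcases (apply_nonneg p.toSeminorm 1).eq_or_lt with h0 | h0
  · rw [← h0]
    exact zero_le_one
  · nlinarith

/-- A copy of the ⋆-algebra `E`, to be equipped with the seminorm `p`. -/
@[nolint unusedArguments]
def Pre (_p : CStarSeminorm E) : Type _ := E

variable (p : CStarSeminorm E)

instance : Ring p.Pre := inferInstanceAs (Ring E)
instance : StarRing p.Pre := inferInstanceAs (StarRing E)
instance : Algebra ℂ p.Pre := inferInstanceAs (Algebra ℂ E)

instance : SeminormedRing p.Pre :=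
  { AddGroupSeminorm.toSeminormedAddCommGroup (E := p.Pre) p.toSeminorm.toAddGroupSeminorm,
    (inferInstance : Ring p.Pre) with
    norm_mul_le := fun x y => p.mul_le x y }

instance : NormedAlgebra ℂ p.Pre where
  norm_smul_le r x := (map_smul_eq_mul p.toSeminorm r (x : E)).le

theorem norm_def (x : p.Pre) : ‖x‖ = p (x : E) := rfl

instance [StarModule ℂ E] : StarModule ℂ p.Pre := inferInstanceAs (StarModule ℂ E)

instance : NormedStarGroup p.Pre where
  norm_star_le x := (p.map_star (x : E)).le

/-- The Hausdorff completion of `E` with respect to the C⋆-seminorm `p`, i.e. the completion of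
`E / ker p`. -/
abbrev CStarCompletion : Type _ := UniformSpace.Completion p.Pre

open UniformSpace in
instance : StarRing p.CStarCompletion where
  star := Completion.map star
  star_involutive x := by
    have hc : UniformContinuous (star : p.Pre → p.Pre) :=
      (starNormedAddGroupHom (E := p.Pre)).uniformContinuous
    induction x using Completion.induction_on with
    | hp => exact isClosed_eq (Completion.continuous_map.comp Completion.continuous_map)
              continuous_id
    | ih x => rw [Completion.map_coe hc, Completion.map_coe hc, star_star]
  star_mul x y := by
    have hc : UniformContinuous (star : p.Pre → p.Pre) :=
      (starNormedAddGroupHom (E := p.Pre)).uniformContinuous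
    have hm : Continuous (Completion.map (star : p.Pre → p.Pre)) := Completion.continuous_map
    induction x, y using Completion.induction_on₂ with
    | hp => exact isClosed_eq (hm.comp (continuous_fst.mul continuous_snd))
              ((hm.comp continuous_snd).mul (hm.comp continuous_fst))
    | ih x y =>
      rw [← Completion.coe_mul, Completion.map_coe hc, Completion.map_coe hc,
        Completion.map_coe hc, star_mul, Completion.coe_mul]
  star_add x y := by
    have hc : UniformContinuous (star : p.Pre → p.Pre) :=
      (starNormedAddGroupHom (E := p.Pre)).uniformContinuous
    have hm : Continuous (Completion.map (star : p.Pre → p.Pre)) := Completion.continuous_map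
    induction x, y using Completion.induction_on₂ with
    | hp => exact isClosed_eq (hm.comp (continuous_fst.add continuous_snd))
              ((hm.comp continuous_fst).add (hm.comp continuous_snd))
    | ih x y =>
      rw [← Completion.coe_add, Completion.map_coe hc, Completion.map_coe hc,
        Completion.map_coe hc, star_add, Completion.coe_add]

theorem star_coe (x : p.Pre) :
    star (x : UniformSpace.Completion p.Pre) = ((star x : p.Pre) : UniformSpace.Completion p.Pre) :=
  UniformSpace.Completion.map_coe
    (starNormedAddGroupHom (E := p.Pre)).uniformContinuous x

theorem continuous_star_completion :
    Continuous (star : p.CStarCompletion → p.CStarCompletion) :=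
  UniformSpace.Completion.continuous_map

variable [StarModule ℂ E]

open UniformSpace in
/-- The completion of a ⋆-algebra with respect to a C⋆-seminorm is a C⋆-algebra. -/
instance : CStarAlgebra p.CStarCompletion where
  norm_smul_le := norm_smul_le
  norm_mul_self_le x := by
    induction x using Completion.induction_on with
    | hp => exact isClosed_le (continuous_norm.mul continuous_norm)
              (continuous_norm.comp (p.continuous_star_completion.mul continuous_id))
    | ih x =>
      rw [p.star_coe, ← Completion.coe_mul, Completion.norm_coe, Completion.norm_coe]
      exact (p.star_mul_self (x : E)).ge
  star_smul r x := by
    induction x using Completion.induction_on with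
    | hp => exact isClosed_eq (p.continuous_star_completion.comp (continuous_const_smul r))
              (p.continuous_star_completion.const_smul (star r))
    | ih x => rw [← Completion.coe_smul, p.star_coe, p.star_coe, star_smul, Completion.coe_smul]

open UniformSpace in
/-- The canonical ⋆-homomorphism from `E` to its completion. -/
def toCompletion : E →⋆ₐ[ℂ] p.CStarCompletion where
  toFun x := Completion.coe' (α := p.Pre) x
  map_one' := Completion.coe_one p.Pre
  map_mul' x y := Completion.coe_mul (α := p.Pre) x y
  map_zero' := Completion.coe_zero (α := p.Pre)
  map_add' x y := Completion.coe_add (α := p.Pre) x y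
  commutes' _ := rfl
  map_star' x := (p.star_coe x).symm

theorem norm_toCompletion (x : E) : ‖p.toCompletion x‖ = p x :=
  UniformSpace.Completion.norm_coe (E := p.Pre) x

end CStarSeminorm

/-- Every C⋆-seminorm on a C⋆-algebra is dominated by the norm. -/
theorem CStarSeminorm.le_norm {A : Type*} [CStarAlgebra A] (p : CStarSeminorm A) (a : A) :
    p a ≤ ‖a‖ := by
  have h := NonUnitalStarAlgHom.norm_apply_le p.toCompletion a
  rwa [p.norm_toCompletion] at h

/-! ### The maximal tensor product -/

section MaxTensor

variable (A B : Type*) [CStarAlgebra A] [CStarAlgebra B]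

variable {A B} in
theorem CStarSeminorm.tmul_le (p : CStarSeminorm (A ⊗[ℂ] B)) (a : A) (b : B) :
    p (a ⊗ₜ[ℂ] b) ≤ ‖a‖ * ‖b‖ := by
  let pA : CStarSeminorm A :=
    { p.toSeminorm.comp (Algebra.TensorProduct.includeLeft : A →ₐ[ℂ] A ⊗[ℂ] B).toLinearMap with
      mul_le_mul' := fun x y => by
        have h := p.mul_le (x ⊗ₜ[ℂ] (1 : B)) (y ⊗ₜ[ℂ] (1 : B))
        rw [Algebra.TensorProduct.tmul_mul_tmul, one_mul] at h
        exact h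
      star_mul_self' := fun x => by
        have h := p.star_mul_self (x ⊗ₜ[ℂ] (1 : B))
        rw [TensorProduct.star_tmul, Algebra.TensorProduct.tmul_mul_tmul, star_one, one_mul] at h
        exact h }
  let pB : CStarSeminorm B :=
    { p.toSeminorm.comp (Algebra.TensorProduct.includeRight : B →ₐ[ℂ] A ⊗[ℂ] B).toLinearMap with
      mul_le_mul' := fun x y => by
        have h := p.mul_le ((1 : A) ⊗ₜ[ℂ] x) ((1 : A) ⊗ₜ[ℂ] y)
        rw [Algebra.TensorProduct.tmul_mul_tmul, one_mul] at h
        exact h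
      star_mul_self' := fun x => by
        have h := p.star_mul_self ((1 : A) ⊗ₜ[ℂ] x)
        rw [TensorProduct.star_tmul, Algebra.TensorProduct.tmul_mul_tmul, star_one, one_mul] at h
        exact h }
  have hA : p (a ⊗ₜ[ℂ] (1 : B)) ≤ ‖a‖ := pA.le_norm a
  have hB : p ((1 : A) ⊗ₜ[ℂ] b) ≤ ‖b‖ := pB.le_norm b
  have h := p.mul_le (a ⊗ₜ[ℂ] (1 : B)) ((1 : A) ⊗ₜ[ℂ] b)
  rw [Algebra.TensorProduct.tmul_mul_tmul, one_mul, mul_one] at h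
  exact h.trans (mul_le_mul hA hB (apply_nonneg p.toSeminorm _) (norm_nonneg a))

variable {A B} in
theorem CStarSeminorm.exists_bound (x : A ⊗[ℂ] B) :
    ∃ C : ℝ, ∀ p : CStarSeminorm (A ⊗[ℂ] B), p x ≤ C := by
  induction x using TensorProduct.induction_on with
  | zero => exact ⟨0, fun p => (map_zero p.toSeminorm).le⟩
  | tmul a b => exact ⟨‖a‖ * ‖b‖, fun p => p.tmul_le a b⟩
  | add x y hx hy =>
    obtain ⟨C, hC⟩ := hx
    obtain ⟨D, hD⟩ := hy
    exact ⟨C + D, fun p => (map_add_le_add p.toSeminorm x y).trans (add_le_add (hC p) (hD p))⟩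

variable {A B} in
theorem CStarSeminorm.bddAbove (x : A ⊗[ℂ] B) :
    BddAbove (Set.range fun p : CStarSeminorm (A ⊗[ℂ] B) => p x) := by
  obtain ⟨C, hC⟩ := CStarSeminorm.exists_bound x
  exact ⟨C, by rintro _ ⟨p, rfl⟩; exact hC p⟩

instance CStarSeminorm.instNonempty {E : Type*} [Ring E] [StarRing E] [Algebra ℂ E] :
    Nonempty (CStarSeminorm E) :=
  ⟨{ (0 : Seminorm ℂ E) with
      mul_le_mul' := fun _ _ => (mul_zero (0 : ℝ)).ge
      star_mul_self' := fun _ => (mul_zero (0 : ℝ)).symm }⟩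

/-- The maximal C⋆-seminorm on the algebraic tensor product of two unital C⋆-algebras: the pointwise
supremum of all C⋆-seminorms. -/
def maxCStarSeminorm : CStarSeminorm (A ⊗[ℂ] B) where
  toFun x := ⨆ p : CStarSeminorm (A ⊗[ℂ] B), p x
  map_zero' := by
    have h : ∀ p : CStarSeminorm (A ⊗[ℂ] B), p 0 = 0 := fun p => map_zero p.toSeminorm
    simp [h]
  add_le' x y := ciSup_le fun p => (map_add_le_add p.toSeminorm x y).trans
    (add_le_add (le_ciSup (CStarSeminorm.bddAbove x) p) (le_ciSup (CStarSeminorm.bddAbove y) p))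
  neg' x := by
    have h : ∀ p : CStarSeminorm (A ⊗[ℂ] B), p (-x) = p x := fun p => map_neg_eq_map p.toSeminorm x
    simp [h]
  smul' r x := by
    have h : ∀ p : CStarSeminorm (A ⊗[ℂ] B), p (r • x) = ‖r‖ * p x :=
      fun p => map_smul_eq_mul p.toSeminorm r x
    simp only [h]
    exact (Real.mul_iSup_of_nonneg (norm_nonneg r) _).symm
  mul_le_mul' x y := ciSup_le fun p => (p.mul_le x y).trans
    (mul_le_mul (le_ciSup (CStarSeminorm.bddAbove x) p) (le_ciSup (CStarSeminorm.bddAbove y) p)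
      (apply_nonneg p.toSeminorm y)
      ((apply_nonneg p.toSeminorm x).trans (le_ciSup (CStarSeminorm.bddAbove x) p)))
  star_mul_self' x := by
    have h0 : 0 ≤ ⨆ p : CStarSeminorm (A ⊗[ℂ] B), p x :=
      Real.iSup_nonneg fun p => apply_nonneg p.toSeminorm x
    refine le_antisymm (ciSup_le fun p => ?_) ?_
    · rw [p.star_mul_self]
      have h := le_ciSup (CStarSeminorm.bddAbove x) p
      exact mul_le_mul h h (apply_nonneg p.toSeminorm x) h0
    · have h1 : 0 ≤ ⨆ p : CStarSeminorm (A ⊗[ℂ] B), p (star x * x) :=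
        Real.iSup_nonneg fun p => apply_nonneg p.toSeminorm _
      refine le_of_eq_of_le (sq _).symm ((Real.le_sqrt h0 h1).mp ?_)
      refine ciSup_le fun p => Real.le_sqrt_of_sq_le ?_
      rw [sq, ← p.star_mul_self]
      exact le_ciSup (CStarSeminorm.bddAbove (star x * x)) p

/-- The maximal tensor product `A ⊗_max B` of unital C⋆-algebras: the completion of the algebraic
tensor product in the maximal C⋆-seminorm. -/
abbrev MaxTensorProduct : Type _ := (maxCStarSeminorm A B).CStarCompletion

variable {A B} in
/-- The elementary tensor `a ⊗ b` in `A ⊗_max B`. -/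
def MaxTensorProduct.tmul (a : A) (b : B) : MaxTensorProduct A B :=
  (maxCStarSeminorm A B).toCompletion (a ⊗ₜ[ℂ] b)

end MaxTensor

end

open scoped TensorProduct ComplexOrder InnerProductSpace

noncomputable section

/-! On the GNS space of `φ`, left multiplication by `A` commutes with right multiplication by `A_φ`.
The latter is bounded because `φ ((x * a)⋆ * (x * a)) = φ (x⋆ * x * (a * a⋆))` for `a` in the
centralizer, and the same cyclicity makes the joint action of `A_φᵒᵖ ⊗ A` respect adjoints
(`map_star_mul_action`). The desired functional is the vector functional of this action at the class
of `1`. The operator norm of the action is a C⋆-seminorm (`actionSeminorm`), hence below the maximal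
one, so the functional extends to the completion. Uniqueness holds since elementary tensors span a
dense subspace and states are continuous. The GNS space is neither quotiented nor completed: `A`
with its seminorm suffices. -/

/-- Turns an operator inequality into an identity, so that only positivity of `φ` on elements `y⋆ *
y` is needed later. -/
theorem CStarAlgebra.exists_star_mul_self_add_eq_algebraMap {B : Type*} [CStarAlgebra B] (a : B) :
    ∃ d : B, star a * a + star d * d = algebraMap ℂ B ((‖a‖ : ℂ) ^ 2) := by
  let _ : PartialOrder B := CStarAlgebra.spectralOrder B
  have _ : StarOrderedRing B := CStarAlgebra.spectralOrderedRing B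
  have h := CStarAlgebra.star_mul_le_algebraMap_norm_sq (a := a)
  obtain ⟨d, hd⟩ := CStarAlgebra.nonneg_iff_eq_star_mul_self.mp (sub_nonneg.mpr h)
  refine ⟨d, ?_⟩
  rw [← hd, add_sub_cancel, IsScalarTower.algebraMap_apply ℝ ℂ B]
  simp

/-! ### The GNS semi-inner product and bounds for left and right multiplication. -/

namespace CStarState

variable {A : Type*} [CStarAlgebra A] (φ : CStarState A)

/-- The underlying space of `A`, to be equipped with the semi-inner product
`⟪x, y⟫ = φ (star x * y)`. -/
@[nolint unusedArguments]
def PreGNS (_φ : CStarState A) : Type _ := A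

instance : AddCommGroup φ.PreGNS := inferInstanceAs (AddCommGroup A)
instance : Module ℂ φ.PreGNS := inferInstanceAs (Module ℂ A)

/-- The identity map from `A` to its semi-inner product space. -/
def toPreGNS : A ≃ₗ[ℂ] φ.PreGNS := LinearEquiv.refl ℂ A

/-- The semi-inner product `⟪x, y⟫ = φ (star x * y)`. -/
abbrev preInnerCore : PreInnerProductSpace.Core ℂ φ.PreGNS where
  inner x y := φ (star (φ.toPreGNS.symm x) * φ.toPreGNS.symm y)
  conj_inner_symm x y := by
    rw [starRingEnd_apply, ← φ.map_star, star_mul, star_star]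
  re_inner_nonneg x := (Complex.le_def.mp (φ.nonneg (φ.toPreGNS.symm x))).1
  add_left x y z := by rw [map_add, star_add, add_mul, map_add]
  smul_left x y r := by simp

instance : SeminormedAddCommGroup φ.PreGNS :=
  InnerProductSpace.Core.toSeminormedAddCommGroup (c := φ.preInnerCore)

instance : InnerProductSpace ℂ φ.PreGNS := InnerProductSpace.ofCore φ.preInnerCore

theorem inner_toPreGNS (x y : A) : ⟪φ.toPreGNS x, φ.toPreGNS y⟫_ℂ = φ (star x * y) := rfl

theorem norm_toPreGNS_sq (x : A) : ((‖φ.toPreGNS x‖ : ℂ)) ^ 2 = φ (star x * x) := by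
  rw [← inner_toPreGNS]
  exact (inner_self_eq_norm_sq_to_K (𝕜 := ℂ) (φ.toPreGNS x)).symm

theorem norm_toPreGNS_one : ‖φ.toPreGNS 1‖ = 1 := by
  have h := φ.norm_toPreGNS_sq 1
  rw [star_one, one_mul, show φ 1 = 1 from φ.map_one'] at h
  exact (pow_eq_one_iff_of_nonneg (norm_nonneg _) two_ne_zero).mp (by exact_mod_cast h)

theorem norm_toPreGNS_le {x y : A} {r : ℝ} (hr : 0 ≤ r)
    (h : φ (star y * y) ≤ (r : ℂ) ^ 2 * φ (star x * x)) :
    ‖φ.toPreGNS y‖ ≤ r * ‖φ.toPreGNS x‖ := by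
  rw [← norm_toPreGNS_sq, ← norm_toPreGNS_sq] at h
  refine (sq_le_sq₀ (norm_nonneg _) (by positivity)).mp ?_
  rw [mul_pow]
  exact_mod_cast h

theorem norm_toPreGNS_mul_left_le (b x : A) :
    ‖φ.toPreGNS (b * x)‖ ≤ ‖b‖ * ‖φ.toPreGNS x‖ := by
  refine φ.norm_toPreGNS_le (norm_nonneg b) ?_
  obtain ⟨d, hd⟩ := CStarAlgebra.exists_star_mul_self_add_eq_algebraMap b
  have h : star (b * x) * (b * x) + star (d * x) * (d * x) = ((‖b‖ : ℂ) ^ 2) • (star x * x) := by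
    calc _ = star x * (star b * b + star d * d) * x := by simp only [star_mul]; noncomm_ring
      _ = _ := by rw [hd, ← Algebra.commutes, mul_assoc, Algebra.smul_def]
  have h' := congrArg φ h
  rw [map_add, map_smul, smul_eq_mul] at h'
  rw [← h']
  exact le_add_of_nonneg_right (φ.nonneg _)

theorem map_star_mul_self_mul_right (a : φ.centralizer) (x : A) :
    φ (star (x * a) * (x * a)) = φ (star x * x * (a * star (a : A))) := by
  rw [star_mul, mul_assoc, (star_mem a.2 : star (a : A) ∈ φ.centralizer)]
  simp only [mul_assoc]

theorem norm_toPreGNS_mul_right_le (a : φ.centralizer) (x : A) :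
    ‖φ.toPreGNS (x * a)‖ ≤ ‖a‖ * ‖φ.toPreGNS x‖ := by
  refine φ.norm_toPreGNS_le (norm_nonneg a) ?_
  -- Applied to `star a`, since cycling produces `a * a⋆`. It is used inside the C⋆-algebra `A_φ`:
  -- `d` must lie in the centralizer for `φ (x⋆ * x * (d⋆ * d))` to be nonnegative.
  obtain ⟨d, hd⟩ := CStarAlgebra.exists_star_mul_self_add_eq_algebraMap (star a)
  have hd' : (a : A) * star (a : A) + star (d : A) * d = algebraMap ℂ A ((‖a‖ : ℂ) ^ 2) := by
    simpa using congrArg (Subtype.val) hd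
  have h := φ.map_star_mul_self_mul_right (star d) x
  have h0 := φ.nonneg (x * (star d : φ.centralizer))
  rw [h] at h0
  have h' := congrArg φ (congrArg (star x * x * ·) hd')
  simp only [mul_add, map_add] at h'
  rw [← Algebra.commutes, ← Algebra.smul_def, map_smul, smul_eq_mul] at h'
  rw [map_star_mul_self_mul_right, ← h']
  simpa using h0

/-! ### The two-sided action and its operator seminorm. -/

/-- The action of `A_φᵒᵖ ⊗ A` on `A` given by `(a ⊗ b) x = b x a`. -/
def action : (φ.centralizer)ᵐᵒᵖ ⊗[ℂ] A →ₐ[ℂ] Module.End ℂ A :=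
  Algebra.TensorProduct.lift
    ((Algebra.lsmul ℂ ℂ A : Aᵐᵒᵖ →ₐ[ℂ] Module.End ℂ A).comp φ.centralizer.subtype.toAlgHom.op)
    (Algebra.lsmul ℂ ℂ A : A →ₐ[ℂ] Module.End ℂ A)
    fun a b => LinearMap.ext fun x => by simp [mul_assoc]

@[simp]
theorem action_tmul (a : φ.centralizer) (b x : A) :
    φ.action (MulOpposite.op a ⊗ₜ b) x = b * x * a := by
  rw [action]
  erw [Algebra.TensorProduct.lift_tmul]
  rfl

/-- On `a ⊗ b` this moves `a` from the right end to the left end under `φ`, which is the centralizer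
condition. -/
theorem map_star_mul_action (t : (φ.centralizer)ᵐᵒᵖ ⊗[ℂ] A) (x y : A) :
    φ (star x * φ.action t y) = φ (star (φ.action (star t) x) * y) := by
  induction t using TensorProduct.induction_on with
  | zero => simp
  | tmul a b =>
    induction a using MulOpposite.rec' with
    | _ a =>
    rw [TensorProduct.star_tmul, ← MulOpposite.op_star, action_tmul, action_tmul]
    have h := a.2 (star x * (b * y))
    simp only [star_mul, star_star, StarMemClass.coe_star, mul_assoc] at h ⊢
    exact h.symm
  | add s t hs ht => simp [mul_add, add_mul, hs, ht]

theorem exists_norm_action_le (t : (φ.centralizer)ᵐᵒᵖ ⊗[ℂ] A) :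
    ∃ C : ℝ, ∀ x, ‖φ.toPreGNS (φ.action t x)‖ ≤ C * ‖φ.toPreGNS x‖ := by
  induction t using TensorProduct.induction_on with
  | zero => exact ⟨0, by simp⟩
  | tmul a b =>
    induction a using MulOpposite.rec' with
    | _ a =>
    refine ⟨‖a‖ * ‖b‖, fun x => ?_⟩
    rw [action_tmul, mul_assoc ‖a‖]
    exact (φ.norm_toPreGNS_mul_right_le a (b * x)).trans
      (mul_le_mul_of_nonneg_left (φ.norm_toPreGNS_mul_left_le b x) (norm_nonneg a))
  | add s t hs ht =>
    obtain ⟨C, hC⟩ := hs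
    obtain ⟨D, hD⟩ := ht
    refine ⟨C + D, fun x => ?_⟩
    rw [map_add, LinearMap.add_apply, map_add, add_mul]
    exact norm_add_le_of_le (hC x) (hD x)

/-- The action of an element of `A_φᵒᵖ ⊗ A` as a bounded operator. -/
def actionCLM (t : (φ.centralizer)ᵐᵒᵖ ⊗[ℂ] A) : φ.PreGNS →L[ℂ] φ.PreGNS :=
  (φ.toPreGNS.toLinearMap ∘ₗ φ.action t ∘ₗ φ.toPreGNS.symm.toLinearMap).mkContinuousOfExistsBound
    (φ.exists_norm_action_le t)

theorem actionCLM_toPreGNS (t : (φ.centralizer)ᵐᵒᵖ ⊗[ℂ] A) (x : A) :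
    φ.actionCLM t (φ.toPreGNS x) = φ.toPreGNS (φ.action t x) := rfl

theorem actionCLM_add (s t : (φ.centralizer)ᵐᵒᵖ ⊗[ℂ] A) :
    φ.actionCLM (s + t) = φ.actionCLM s + φ.actionCLM t :=
  ContinuousLinearMap.ext fun x => by
    obtain ⟨x, rfl⟩ := φ.toPreGNS.surjective x
    simp [actionCLM_toPreGNS]

theorem actionCLM_smul (r : ℂ) (t : (φ.centralizer)ᵐᵒᵖ ⊗[ℂ] A) :
    φ.actionCLM (r • t) = r • φ.actionCLM t :=
  ContinuousLinearMap.ext fun x => by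
    obtain ⟨x, rfl⟩ := φ.toPreGNS.surjective x
    simp [actionCLM_toPreGNS]

theorem actionCLM_mul (s t : (φ.centralizer)ᵐᵒᵖ ⊗[ℂ] A) :
    φ.actionCLM (s * t) = φ.actionCLM s * φ.actionCLM t :=
  ContinuousLinearMap.ext fun x => by
    obtain ⟨x, rfl⟩ := φ.toPreGNS.surjective x
    simp [actionCLM_toPreGNS]

theorem inner_actionCLM (t : (φ.centralizer)ᵐᵒᵖ ⊗[ℂ] A) (x y : φ.PreGNS) :
    ⟪x, φ.actionCLM t y⟫_ℂ = ⟪φ.actionCLM (star t) x, y⟫_ℂ := by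
  obtain ⟨x, rfl⟩ := φ.toPreGNS.surjective x
  obtain ⟨y, rfl⟩ := φ.toPreGNS.surjective y
  exact φ.map_star_mul_action t x y

/-- The usual C⋆-identity argument, by Cauchy–Schwarz; `star t` supplies the adjoint, which need not
exist in general without completeness. -/
theorem norm_actionCLM_sq_le (t : (φ.centralizer)ᵐᵒᵖ ⊗[ℂ] A) :
    ‖φ.actionCLM t‖ ^ 2 ≤ ‖φ.actionCLM (star t * t)‖ := by
  refine (Real.le_sqrt (norm_nonneg (φ.actionCLM t)) (norm_nonneg (φ.actionCLM _))).mp ?_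
  refine ContinuousLinearMap.opNorm_le_bound _ (Real.sqrt_nonneg _) fun x => ?_
  refine (sq_le_sq₀ (norm_nonneg _) (by positivity)).mp ?_
  rw [mul_pow, Real.sq_sqrt (norm_nonneg (φ.actionCLM _))]
  have h : ⟪φ.actionCLM (star t * t) x, x⟫_ℂ = ((‖φ.actionCLM t x‖ ^ 2 : ℝ) : ℂ) := by
    rw [actionCLM_mul, mul_apply_eq_comp, ← inner_actionCLM]
    simp
  calc ‖φ.actionCLM t x‖ ^ 2 = ‖⟪φ.actionCLM (star t * t) x, x⟫_ℂ‖ := by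
        rw [h, Complex.norm_real, Real.norm_of_nonneg (sq_nonneg _)]
    _ ≤ ‖φ.actionCLM (star t * t) x‖ * ‖x‖ := norm_inner_le_norm _ _
    _ ≤ ‖φ.actionCLM (star t * t)‖ * ‖x‖ * ‖x‖ := by
        gcongr
        exact ContinuousLinearMap.le_opNorm _ _
    _ = _ := by ring

theorem norm_actionCLM_mul_le (s t : (φ.centralizer)ᵐᵒᵖ ⊗[ℂ] A) :
    ‖φ.actionCLM (s * t)‖ ≤ ‖φ.actionCLM s‖ * ‖φ.actionCLM t‖ := by
  rw [actionCLM_mul]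
  exact norm_mul_le (φ.actionCLM s) (φ.actionCLM t)

theorem norm_actionCLM_le_star (t : (φ.centralizer)ᵐᵒᵖ ⊗[ℂ] A) :
    ‖φ.actionCLM t‖ ≤ ‖φ.actionCLM (star t)‖ := by
  have h := (φ.norm_actionCLM_sq_le t).trans (φ.norm_actionCLM_mul_le (star t) t)
  rcases (norm_nonneg (φ.actionCLM t)).eq_or_lt with h0 | h0
  · rw [← h0]
    exact norm_nonneg (φ.actionCLM (star t))
  · rw [sq] at h
    exact le_of_mul_le_mul_right h h0

/-- The C⋆-seminorm on `A_φᵒᵖ ⊗ A` induced by its action on the GNS space of `φ`. -/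
def actionSeminorm : CStarSeminorm ((φ.centralizer)ᵐᵒᵖ ⊗[ℂ] A) where
  toSeminorm := Seminorm.ofSMulLE (fun t => ‖φ.actionCLM t‖)
    (by
      rw [show φ.actionCLM 0 = 0 by simpa using φ.actionCLM_add 0 0]
      exact ContinuousLinearMap.opNorm_zero)
    (fun s t => by rw [actionCLM_add]; exact norm_add_le (φ.actionCLM s) (φ.actionCLM t))
    (fun r t => by rw [actionCLM_smul]; exact ContinuousLinearMap.opNorm_smul_le r _)
  mul_le_mul' := φ.norm_actionCLM_mul_le
  star_mul_self' t := by
    have h := φ.norm_actionCLM_le_star (star t)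
    rw [star_star] at h
    refine le_antisymm ((φ.norm_actionCLM_mul_le (star t) t).trans ?_) ?_
    · exact mul_le_mul_of_nonneg_right h (norm_nonneg (φ.actionCLM t))
    · exact (sq _).symm.trans_le (φ.norm_actionCLM_sq_le t)

/-! ### The vector functional at `1`. -/

/-- The functional `a ⊗ b ↦ φ (b * a) = φ (a * b)` on the algebraic tensor product. -/
def tensorFunctional : (φ.centralizer)ᵐᵒᵖ ⊗[ℂ] A →ₗ[ℂ] ℂ :=
  φ.toLinearMap ∘ₗ LinearMap.applyₗ (1 : A) ∘ₗ φ.action.toLinearMap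

theorem tensorFunctional_apply (t : (φ.centralizer)ᵐᵒᵖ ⊗[ℂ] A) :
    φ.tensorFunctional t = φ (φ.action t 1) := rfl

theorem tensorFunctional_tmul (a : φ.centralizer) (b : A) :
    φ.tensorFunctional (MulOpposite.op a ⊗ₜ b) = φ (a * b) := by
  rw [tensorFunctional_apply, action_tmul, mul_one]
  exact (a.2 b).symm

/-- By the adjoint relation the value is `φ (y⋆ * y)` with `y = φ.action t 1`. -/
theorem tensorFunctional_star_mul_self_nonneg (t : (φ.centralizer)ᵐᵒᵖ ⊗[ℂ] A) :
    0 ≤ φ.tensorFunctional (star t * t) := by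
  have h := φ.map_star_mul_action (star t) 1 (φ.action t 1)
  rw [star_one, one_mul, star_star] at h
  rw [tensorFunctional_apply, map_mul, Module.End.mul_apply, h]
  exact φ.nonneg _

theorem norm_tensorFunctional_le (t : (φ.centralizer)ᵐᵒᵖ ⊗[ℂ] A) :
    ‖φ.tensorFunctional t‖ ≤ maxCStarSeminorm (φ.centralizer)ᵐᵒᵖ A t := by
  have h : φ.tensorFunctional t = ⟪φ.toPreGNS 1, φ.actionCLM t (φ.toPreGNS 1)⟫_ℂ := by
    rw [actionCLM_toPreGNS, inner_toPreGNS, star_one, one_mul, tensorFunctional_apply]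
  calc ‖φ.tensorFunctional t‖ ≤ ‖φ.toPreGNS 1‖ * ‖φ.actionCLM t (φ.toPreGNS 1)‖ := by
        rw [h]
        exact norm_inner_le_norm _ _
    _ ≤ ‖φ.actionCLM t‖ := by
        simpa [norm_toPreGNS_one] using (φ.actionCLM t).le_opNorm (φ.toPreGNS 1)
    _ ≤ _ := le_ciSup (CStarSeminorm.bddAbove t) φ.actionSeminorm

end CStarState

/-! ### Extension to the completion, and uniqueness. -/

namespace CStarSeminorm

variable {E : Type*} [Ring E] [StarRing E] [Algebra ℂ E] (p : CStarSeminorm E)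

theorem denseRange_toCompletion : DenseRange p.toCompletion :=
  UniformSpace.Completion.denseRange_coe (α := p.Pre)

variable [StarModule ℂ E]

theorem exists_continuousLinearMap_extension (f : E →ₗ[ℂ] ℂ) (hf : ∀ x, ‖f x‖ ≤ p x) :
    ∃ F : p.CStarCompletion →L[ℂ] ℂ, ∀ x, F (p.toCompletion x) = f x :=
  ⟨f.extendOfNorm p.toCompletion.toAlgHom.toLinearMap, fun x =>
    LinearMap.extendOfNorm_eq p.denseRange_toCompletion
      ⟨1, fun x => by simpa [p.norm_toCompletion] using hf x⟩ x⟩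

/-- A positive unital functional dominated by a C⋆-seminorm extends to a state on the completion. -/
theorem exists_state_extension (f : E →ₗ[ℂ] ℂ) (hf : ∀ x, ‖f x‖ ≤ p x)
    (hpos : ∀ x, 0 ≤ f (star x * x)) (hone : f 1 = 1) :
    ∃ Φ : CStarState p.CStarCompletion, ∀ x, Φ (p.toCompletion x) = f x := by
  obtain ⟨F, hF⟩ := p.exists_continuousLinearMap_extension f hf
  refine ⟨⟨F.toLinearMap, fun y => ?_, ?_⟩, hF⟩
  -- Positivity is a closed condition on `y`, so it passes from the dense image of `E` to the
  -- completion.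
  · refine p.denseRange_toCompletion.induction_on (p := fun y => 0 ≤ F (star y * y)) y ?_ ?_
    · exact isClosed_le continuous_const
        (F.continuous.comp (p.continuous_star_completion.mul continuous_id))
    · intro x
      rw [← StarHomClass.map_star, ← map_mul, hF]
      exact hpos x
  · exact (congrArg F (map_one p.toCompletion)).symm.trans ((hF 1).trans hone)

end CStarSeminorm

theorem CStarState.ext_toLinearMap {A : Type*} [CStarAlgebra A] {φ ψ : CStarState A}
    (h : ∀ a, φ a = ψ a) : φ = ψ := by
  cases φ
  cases ψ
  congr
  exact LinearMap.ext h

theorem MaxTensorProduct.state_ext {A B : Type*} [CStarAlgebra A] [CStarAlgebra B]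
    {Φ Ψ : CStarState (MaxTensorProduct A B)} (h : ∀ a b, Φ (tmul a b) = Ψ (tmul a b)) :
    Φ = Ψ := by
  refine CStarState.ext_toLinearMap fun y => congrFun ?_ y
  refine (maxCStarSeminorm A B).denseRange_toCompletion.equalizer Φ.continuous Ψ.continuous ?_
  have hl : Φ.toLinearMap ∘ₗ (maxCStarSeminorm A B).toCompletion.toAlgHom.toLinearMap =
      Ψ.toLinearMap ∘ₗ (maxCStarSeminorm A B).toCompletion.toAlgHom.toLinearMap :=
    TensorProduct.ext' h
  exact funext fun x => LinearMap.congr_fun hl x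

theorem lemma1 {A : Type*} [CStarAlgebra A] (φ : CStarState A) :
    ∃! Φ : CStarState (MaxTensorProduct (φ.centralizer)ᵐᵒᵖ A),
      ∀ (a : φ.centralizer) (b : A),
        Φ (MaxTensorProduct.tmul (MulOpposite.op a) b) = φ ((a : A) * b) := by
  obtain ⟨Φ, hΦ⟩ := (maxCStarSeminorm (φ.centralizer)ᵐᵒᵖ A).exists_state_extension
    φ.tensorFunctional φ.norm_tensorFunctional_le φ.tensorFunctional_star_mul_self_nonneg (by
      have h := φ.tensorFunctional_tmul 1 1
      rw [OneMemClass.coe_one, mul_one] at h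
      exact h.trans φ.map_one')
  have h : ∀ (a : φ.centralizer) (b : A),
      Φ (MaxTensorProduct.tmul (MulOpposite.op a) b) = φ ((a : A) * b) :=
    fun a b => (hΦ _).trans (φ.tensorFunctional_tmul a b)
  refine ⟨Φ, h, fun Ψ hΨ => MaxTensorProduct.state_ext fun a b => ?_⟩
  exact (hΨ a.unop b).trans (h a.unop b).symm

end
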